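/- Theorem (Strong XOR lemma). A randomized decision tree over $\{\pm1\}^m$ is a probability distribution over finite deterministic decision trees, each internal node of which queries one input coordinate and each leaf of which is labeled by an output in $\{\pm1\}$. For $g:\{\pm1\}^m\to\{\pm1\}$, a probability distribution $\nu$ on $\{\pm1\}^m$ and $\varepsilon\in\mathbb{R}$, let $\overline{\mathrm{Depth}}^{\nu}(g,\varepsilon)$ be the minimum (infimum), over all randomized decision trees $\mathcal{T}$ with $\Pr_{x\sim\nu,\,T\sim\mathcal{T}}[T(x)\ne g(x)]\le\varepsilon$, of the expected number of queries made by $T\sim\mathcal{T}$ on a random input $x\sim\nu$; it is $+\infty$ if there is no such tree, i.e. if $\varepsilon<0$. For $f:\{\pm1\}^n\to\{\pm1\}$ let $f^{\oplus k}:(\{\pm1\}^n)^k\to\{\pm1\}$ be $f^{\oplus k}(X^{(1)},\dots,X^{(k)})=\prod_{i=1}^k f(X^{(i)})$, and let $\mu^k$ be the $k$-fold product distribution of $\mu$. There are absolute constants $c,C>0$ such that for all $n,k\in\mathbb{N}$, every function $f:\{\pm1\}^n\to\{\pm1\}$, every probability distribution $\mu$ on $\{\pm1\}^n$, and all $\gamma,\delta\in(0,1)$,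 $$\overline{\mathrm{Depth}}^{\mu^k}\!\left(f^{\oplus k},\ \tfrac12\left(1-e^{-c\,\delta k}-\gamma\right)\right)\ \ge\ C\cdot\frac{\gamma^2 k}{\log(1/\delta)}\cdot\overline{\mathrm{Depth}}^{\mu}(f,\delta).$$ -/

import Mathlib

open scoped ENNReal

/-!
Bits are elements of `ℤˣ = {1, -1}`; an input with coordinates indexed by `ι` is a function
`ι → ℤˣ`. An element `X` of `({±1}^n)^k` is a function `Fin k × Fin n → ℤˣ`, whose `i`-th block
`X^(i)` is `fun j => X (i, j)`.
-/

/-- Deterministic decision trees querying coordinates in `ι`: a leaf carries an output bit, an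
internal node carries the queried coordinate and its left and right children. -/
inductive DecisionTree (ι : Type) : Type where
  | leaf (b : ℤˣ) : DecisionTree ι
  | node (i : ι) (left right : DecisionTree ι) : DecisionTree ι

namespace DecisionTree

variable {ι : Type}

/-- The output `T(x)`: at a node querying `i` go left if `x i = -1` and right if `x i = 1`. -/
def eval : DecisionTree ι → (ι → ℤˣ) → ℤˣ
  | leaf b, _ => b
  | node i l r, x => if x i = -1 then l.eval x else r.eval x

/-- The number of queries that the tree makes on input `x`. -/
def numQueries : DecisionTree ι → (ι → ℤˣ) → ℕ
  | leaf _, _ => 0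
  | node i l r, x => 1 + if x i = -1 then l.numQueries x else r.numQueries x

variable [Fintype ι] [DecidableEq ι]

/-- The expected number of queries of a deterministic tree on a random input `x ∼ μ`. -/
noncomputable def expectedDepth (μ : PMF (ι → ℤˣ)) (T : DecisionTree ι) : ℝ≥0∞ :=
  ∑ x, μ x * (T.numQueries x : ℝ≥0∞)

/-- The error probability `Pr_{x ∼ μ}[T(x) ≠ f(x)]` of a deterministic tree. -/
noncomputable def error (μ : PMF (ι → ℤˣ)) (f : (ι → ℤˣ) → ℤˣ) (T : DecisionTree ι) : ℝ≥0∞ :=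
  ∑ x, if T.eval x ≠ f x then μ x else 0

end DecisionTree

/-- A randomized decision tree is a probability distribution over deterministic decision trees.
(There are only countably many deterministic trees over a finite index set, so a distribution is
given by its probability mass function.) -/
abbrev RandomizedDecisionTree (ι : Type) : Type := PMF (DecisionTree ι)

namespace RandomizedDecisionTree

variable {ι : Type} [Fintype ι] [DecidableEq ι]

/-- The expected depth `E_{T ∼ R}[expected depth of T under μ]`; it may be infinite. -/
noncomputable def expectedDepth (μ : PMF (ι → ℤˣ)) (R : RandomizedDecisionTree ι) : ℝ≥0∞ :=
  ∑' T : DecisionTree ι, R T * T.expectedDepth μ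

/-- The error probability `Pr_{T ∼ R, x ∼ μ}[T(x) ≠ f(x)]`. -/
noncomputable def error (μ : PMF (ι → ℤˣ)) (f : (ι → ℤˣ) → ℤˣ) (R : RandomizedDecisionTree ι) :
    ℝ≥0∞ :=
  ∑' T : DecisionTree ι, R T * T.error μ f

end RandomizedDecisionTree

/-- The distributional query complexity of `f` at error `ε` under `μ`: the least expected depth of
a randomized decision tree that computes `f` with error probability at most `ε` when `x ∼ μ`.
It is `∞` if there is no such tree, that is, if `ε < 0`. (An error probability is at most `1`,
so `toReal` loses nothing.) -/
noncomputable def depthComplexity {ι : Type} [Fintype ι] [DecidableEq ι] (μ : PMF (ι → ℤˣ))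
    (f : (ι → ℤˣ) → ℤˣ) (ε : ℝ) : ℝ≥0∞ :=
  ⨅ (R : RandomizedDecisionTree ι) (_ : (R.error μ f).toReal ≤ ε), R.expectedDepth μ

/-- The `k`-fold product distribution `μ^k` on `({±1}^n)^k`. -/
noncomputable def productPower {n : ℕ} (μ : PMF (Fin n → ℤˣ)) (k : ℕ) :
    PMF (Fin k × Fin n → ℤˣ) :=
  PMF.ofFintype (fun X => ∏ i : Fin k, μ (fun j => X (i, j))) (by
    have h := Equiv.sum_comp (Equiv.curry (Fin k) (Fin n) ℤˣ)
      (fun Y : Fin k → Fin n → ℤˣ => ∏ i, μ (Y i))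
    have h1 : ∑ x, μ x = 1 := by rw [← tsum_fintype (L := .unconditional _)]; exact μ.tsum_coe
    refine h.trans ?_
    rw [← Fintype.prod_sum (fun (_ : Fin k) x => μ x)]
    simp [h1])

/-- The `k`-fold XOR `f^{⊕k}(X^(1), …, X^(k)) = f(X^(1)) ⋯ f(X^(k))`, in `±1` notation. -/
def xorPower {n : ℕ} (f : (Fin n → ℤˣ) → ℤˣ) (k : ℕ) (X : Fin k × Fin n → ℤˣ) : ℤˣ :=
  ∏ i : Fin k, f (fun j => X (i, j))

/-! Write the advantage of a tree as the expectation of its output times the target, so that the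
error is half of one minus the advantage. Suppose a randomized tree for the XOR has expected depth
`D`, and put `d = D / k`.

Amplification: if a tree of expected depth at most `d` had pointwise advantage at least `a` outside
a set of measure at most `δ / 2`, the majority of `t ≈ log(1/δ) / a²` runs would compute `f` with
error `δ` and expected depth `t d` (`depthComplexity_le_of_amplify`). So if the complexity of `f`
exceeds `t d`, every such tree has advantage below `a` on a set of measure at least `δ / 2`. That
set depends on the tree. A near-minimizer of a smooth convex potential over the convex class of such
trees turns this into one measure `H ≤ 1`, of density `p ≥ δ / 2`, against which all of them have
advantage at most `3 a p` (`exists_hardcore`).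

XOR step: at each leaf of a tree on `k` blocks the conditional input is a product, so the advantage
there is a product of block correlations. Either the relative correlations with `H` add up to at
most `θ`, and the product shrinks because each block loses about its `H`-mass; or they exceed `θ`,
and the trivial bound is charged to them (`prod_le_exp_mul_prod_add`). Summed over the leaves, the
first case gives `exp(2θ) (1 - p/2)^k`. The second gives the advantages against `H` of single-block
trees whose query counts add up to that of the original tree (`sum_eval_mul_prod_le`). A random
block therefore costs `D / k` on average, hardness of `H` applies, and the XOR advantage is at most
`exp(-p k / 4) + 24 a` (`sum_xorPower_mul_mean_le`). -/

namespace PMF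

/-! ### Expectations under discrete distributions. -/

variable {α β : Type*}

/-- The expectation of a (bounded) real function. -/
noncomputable def expect (p : PMF α) (F : α → ℝ) : ℝ := ∑' a, (p a).toReal * F a

lemma summable_toReal (p : PMF α) : Summable fun a => (p a).toReal :=
  ENNReal.summable_toReal p.tsum_coe_ne_top

lemma tsum_toReal (p : PMF α) : ∑' a, (p a).toReal = 1 := by
  rw [← ENNReal.tsum_toReal_eq (fun a => p.apply_ne_top a), p.tsum_coe, ENNReal.toReal_one]

lemma sum_toReal [Fintype α] (p : PMF α) : ∑ a, (p a).toReal = 1 := by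
  rw [← p.tsum_toReal, tsum_fintype]

lemma summable_expect (p : PMF α) {F : α → ℝ} {B : ℝ} (hF : ∀ a, |F a| ≤ B) :
    Summable fun a => (p a).toReal * F a := by
  refine Summable.of_norm_bounded (p.summable_toReal.mul_right B) fun a => ?_
  rw [norm_mul, Real.norm_eq_abs, Real.norm_eq_abs, abs_of_nonneg ENNReal.toReal_nonneg]
  exact mul_le_mul_of_nonneg_left (hF a) ENNReal.toReal_nonneg

lemma expect_const (p : PMF α) (c : ℝ) : p.expect (fun _ => c) = c := by
  rw [expect, tsum_mul_right, tsum_toReal, one_mul]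

lemma expect_mul_left (p : PMF α) (c : ℝ) (F : α → ℝ) :
    p.expect (fun a => c * F a) = c * p.expect F := by
  rw [expect, expect, ← tsum_mul_left]
  exact tsum_congr fun a => by ring

lemma expect_mono (p : PMF α) {F G : α → ℝ} {B C : ℝ} (hF : ∀ a, |F a| ≤ B)
    (hG : ∀ a, |G a| ≤ C) (h : ∀ a, F a ≤ G a) : p.expect F ≤ p.expect G :=
  (p.summable_expect hF).tsum_le_tsum
    (fun a => mul_le_mul_of_nonneg_left (h a) ENNReal.toReal_nonneg) (p.summable_expect hG)

lemma expect_add (p : PMF α) {F G : α → ℝ} {B C : ℝ} (hF : ∀ a, |F a| ≤ B)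
    (hG : ∀ a, |G a| ≤ C) : p.expect (fun a => F a + G a) = p.expect F + p.expect G := by
  rw [expect, expect, expect, ← (p.summable_expect hF).tsum_add (p.summable_expect hG)]
  exact tsum_congr fun a => by ring

lemma expect_sum (p : PMF α) {ι : Type*} (s : Finset ι) {F : ι → α → ℝ} {B : ι → ℝ}
    (hF : ∀ i a, |F i a| ≤ B i) :
    p.expect (fun a => ∑ i ∈ s, F i a) = ∑ i ∈ s, p.expect (F i) := by
  simp only [expect, Finset.mul_sum]
  exact Summable.tsum_finsetSum fun i _ => p.summable_expect (hF i)

lemma abs_expect_le (p : PMF α) {F : α → ℝ} {B : ℝ} (hF : ∀ a, |F a| ≤ B) :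
    |p.expect F| ≤ B := by
  rw [abs_le]
  constructor
  · rw [← p.expect_const (-B)]
    exact p.expect_mono (fun _ => le_rfl) hF fun a => (abs_le.1 (hF a)).1
  · rw [← p.expect_const B]
    exact p.expect_mono hF (fun _ => le_rfl) fun a => (abs_le.1 (hF a)).2

lemma expect_fintype [Fintype α] (p : PMF α) (F : α → ℝ) :
    p.expect F = ∑ a, (p a).toReal * F a := tsum_fintype _

lemma expect_pure (a : α) (F : α → ℝ) : (PMF.pure a).expect F = F a := by
  rw [expect, tsum_eq_single a]
  · simp
  · intro b hb
    simp [hb]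

lemma expect_bind (p : PMF α) (g : α → PMF β) {F : β → ℝ} {B : ℝ} (hF : ∀ b, |F b| ≤ B) :
    (p.bind g).expect F = p.expect fun a => (g a).expect F := by
  have hsum : Summable fun q : α × β => (p q.1).toReal * (g q.1 q.2).toReal := by
    have h1 : ∑' q : α × β, p q.1 * g q.1 q.2 = 1 := by
      rw [ENNReal.tsum_prod (f := fun a b => p a * g a b)]
      simp only [ENNReal.tsum_mul_left, PMF.tsum_coe, mul_one]
    have h2 := ENNReal.summable_toReal (h1.trans_ne ENNReal.one_ne_top)
    simpa only [ENNReal.toReal_mul] using h2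
  have hs : Summable fun q : α × β => (p q.1).toReal * (g q.1 q.2).toReal * F q.2 := by
    refine Summable.of_norm_bounded (hsum.mul_right B) fun q => ?_
    rw [norm_mul, Real.norm_eq_abs, Real.norm_eq_abs, abs_of_nonneg (by positivity)]
    exact mul_le_mul_of_nonneg_left (hF q.2) (by positivity)
  calc (p.bind g).expect F
      = ∑' b, ∑' a, (p a).toReal * (g a b).toReal * F b := by
        refine tsum_congr fun b => ?_
        rw [PMF.bind_apply, ENNReal.tsum_toReal_eq, tsum_mul_right]
        · simp only [ENNReal.toReal_mul]
        · exact fun a => ENNReal.mul_ne_top (p.apply_ne_top a) ((g a).apply_ne_top b)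
    _ = ∑' a, ∑' b, (p a).toReal * (g a b).toReal * F b := Summable.tsum_comm hs
    _ = p.expect fun a => (g a).expect F := by
        refine tsum_congr fun a => ?_
        simp only [expect]
        rw [← tsum_mul_left]
        exact tsum_congr fun b => by ring

lemma tsum_bind_mul (p : PMF α) (g : α → PMF β) (F : β → ℝ≥0∞) :
    ∑' b, (p.bind g) b * F b = ∑' a, p a * ∑' b, g a b * F b := by
  simp only [PMF.bind_apply, ← ENNReal.tsum_mul_right, ← ENNReal.tsum_mul_left]
  rw [ENNReal.tsum_comm]
  simp only [mul_assoc]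

lemma tsum_pure_mul (a : α) (F : α → ℝ≥0∞) : ∑' b, PMF.pure a b * F b = F a := by
  rw [tsum_eq_single a]
  · simp
  · intro b hb
    simp [hb]

end PMF

lemma Int.units_abs_cast (u : ℤˣ) : |((u : ℤ) : ℝ)| = 1 := by
  rcases Int.units_eq_one_or u with rfl | rfl <;> simp

/-! ### Composition of trees, mean output and error. -/

namespace DecisionTree

variable {ι : Type}

/-- Continue at each leaf labelled `b` with the tree `A b`. -/
def graft : DecisionTree ι → (ℤˣ → DecisionTree ι) → DecisionTree ι
  | leaf b, A => A b
  | node i l r, A => node i (l.graft A) (r.graft A)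

lemma eval_graft (T : DecisionTree ι) (A : ℤˣ → DecisionTree ι) (x : ι → ℤˣ) :
    (T.graft A).eval x = (A (T.eval x)).eval x := by
  induction T with
  | leaf b => rfl
  | node i l r hl hr => by_cases h : x i = -1 <;> simp [graft, eval, h, hl, hr]

lemma numQueries_graft (T : DecisionTree ι) (A : ℤˣ → DecisionTree ι) (x : ι → ℤˣ) :
    (T.graft A).numQueries x = T.numQueries x + (A (T.eval x)).numQueries x := by
  induction T with
  | leaf b => simp [graft, eval, numQueries]
  | node i l r hl hr =>
    by_cases h : x i = -1 <;> simp [graft, eval, numQueries, h, hl, hr, add_assoc]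

end DecisionTree

namespace RandomizedDecisionTree

variable {ι : Type}

/-- The expected output of a randomized tree on a fixed input. -/
noncomputable def mean (R : RandomizedDecisionTree ι) (x : ι → ℤˣ) : ℝ :=
  R.expect fun T => ((T.eval x : ℤ) : ℝ)

/-- The expected number of queries of a randomized tree on a fixed input. -/
noncomputable def queriesAt (R : RandomizedDecisionTree ι) (x : ι → ℤˣ) : ℝ≥0∞ :=
  ∑' T : DecisionTree ι, R T * (T.numQueries x : ℝ≥0∞)

lemma abs_mean_le (R : RandomizedDecisionTree ι) (x : ι → ℤˣ) : |R.mean x| ≤ 1 :=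
  PMF.abs_expect_le _ fun _ => (Int.units_abs_cast _).le

lemma mean_bind {α : Type*} (p : PMF α) (g : α → RandomizedDecisionTree ι) (x : ι → ℤˣ) :
    mean (p.bind g) x = p.expect fun a => mean (g a) x :=
  PMF.expect_bind _ _ fun _ => (Int.units_abs_cast _).le

variable [Fintype ι] [DecidableEq ι]

lemma expectedDepth_eq_sum_queriesAt (μ : PMF (ι → ℤˣ)) (R : RandomizedDecisionTree ι) :
    R.expectedDepth μ = ∑ x, μ x * R.queriesAt x := by
  simp only [expectedDepth, DecisionTree.expectedDepth, queriesAt, ← ENNReal.tsum_mul_left,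
    ← tsum_fintype (L := .unconditional _)]
  rw [ENNReal.tsum_comm]
  exact tsum_congr fun x => tsum_congr fun T => by ring

lemma expectedDepth_bind {α : Type*} (μ : PMF (ι → ℤˣ)) (p : PMF α)
    (g : α → RandomizedDecisionTree ι) :
    expectedDepth μ (p.bind g) = ∑' a, p a * expectedDepth μ (g a) :=
  PMF.tsum_bind_mul _ _ _

lemma expectedDepth_pure (μ : PMF (ι → ℤˣ)) (T : DecisionTree ι) :
    expectedDepth μ (PMF.pure T) = T.expectedDepth μ :=
  PMF.tsum_pure_mul _ _

omit [Fintype ι] [DecidableEq ι] in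
lemma mean_pure (T : DecisionTree ι) (x : ι → ℤˣ) :
    mean (PMF.pure T) x = ((T.eval x : ℤ) : ℝ) :=
  PMF.expect_pure _ _

lemma toReal_treeError (μ : PMF (ι → ℤˣ)) (f : (ι → ℤˣ) → ℤˣ) (T : DecisionTree ι) :
    (T.error μ f).toReal = ∑ x, (μ x).toReal * (if T.eval x ≠ f x then 1 else 0) := by
  rw [DecisionTree.error, ENNReal.toReal_sum]
  · refine Finset.sum_congr rfl fun x _ => ?_
    split_ifs <;> simp
  · intro x _
    split_ifs
    · exact μ.apply_ne_top x
    · exact ENNReal.zero_ne_top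

lemma toReal_error (μ : PMF (ι → ℤˣ)) (f : (ι → ℤˣ) → ℤˣ) (R : RandomizedDecisionTree ι) :
    (R.error μ f).toReal =
      ∑ x, (μ x).toReal * R.expect fun T => if T.eval x ≠ f x then 1 else 0 := by
  have h1 : ∀ T : DecisionTree ι, T.error μ f ≤ 1 := fun T => by
    rw [← μ.tsum_coe, tsum_fintype]
    exact Finset.sum_le_sum fun x _ => by split_ifs <;> simp
  rw [error, ENNReal.tsum_toReal_eq]
  · simp only [ENNReal.toReal_mul, toReal_treeError]
    rw [← PMF.expect, PMF.expect_sum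
      (F := fun x (T : DecisionTree ι) => (μ x).toReal * if T.eval x ≠ f x then 1 else 0)
      (B := fun x => (μ x).toReal)]
    · simp only [PMF.expect_mul_left]
    · intro x T
      split_ifs <;> simp
  · exact fun T => ENNReal.mul_ne_top (R.apply_ne_top T)
      (ne_top_of_le_ne_top ENNReal.one_ne_top (h1 T))

lemma toReal_error_eq_mean (μ : PMF (ι → ℤˣ)) (f : (ι → ℤˣ) → ℤˣ)
    (R : RandomizedDecisionTree ι) :
    (R.error μ f).toReal =
      1 / 2 * (1 - ∑ x, (μ x).toReal * (((f x : ℤ) : ℝ) * R.mean x)) := by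
  have h : ∀ x, (R.expect fun T => if T.eval x ≠ f x then (1 : ℝ) else 0) =
      1 / 2 + -(1 / 2) * (((f x : ℤ) : ℝ) * R.mean x) := by
    intro x
    rw [mean, ← PMF.expect_mul_left, ← PMF.expect_mul_left]
    nth_rw 1 [← R.expect_const (1 / 2)]
    rw [← PMF.expect_add (B := 1 / 2) (C := 1 / 2)]
    · congr 1
      ext T
      rcases Int.units_eq_one_or (T.eval x) with h | h <;>
      rcases Int.units_eq_one_or (f x) with h' | h' <;> simp [h, h'] <;> norm_num
    · intro; norm_num
    · intro T
      rw [abs_mul, abs_mul, Int.units_abs_cast, Int.units_abs_cast]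
      norm_num
  rw [toReal_error]
  simp only [h, mul_add, mul_sub, Finset.sum_add_distrib]
  rw [← Finset.sum_mul, PMF.sum_toReal, Finset.mul_sum, one_mul, mul_one, sub_eq_add_neg,
    ← Finset.sum_neg_distrib]
  congr 1
  exact Finset.sum_congr rfl fun x _ => by ring

end RandomizedDecisionTree

/-! ### Amplification by majority vote. -/

namespace RandomizedDecisionTree

variable {ι : Type}

lemma abs_indicator_le (p : Prop) [Decidable p] : |(if p then 1 else 0 : ℝ)| ≤ 1 := by
  split_ifs <;> simp

/-- The sign of `s` plus the sum of the outputs of `t` independent runs. -/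
noncomputable def majority (R : RandomizedDecisionTree ι) : ℕ → ℤ → RandomizedDecisionTree ι
  | 0, s => PMF.pure (.leaf (if 0 ≤ s then 1 else -1))
  | t + 1, s => R.bind fun T => (majority R t (s + 1)).bind fun A =>
      (majority R t (s - 1)).bind fun B => PMF.pure (T.graft fun b => if b = 1 then A else B)

lemma expect_majority_succ (R : RandomizedDecisionTree ι) (t : ℕ) (s : ℤ) (x : ι → ℤˣ)
    {F : ℤˣ → ℝ} {B : ℝ} (hF : ∀ b, |F b| ≤ B) :
    (majority R (t + 1) s).expect (fun T => F (T.eval x)) =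
      R.expect fun T => (majority R t (s + (T.eval x : ℤ))).expect fun A => F (A.eval x) := by
  rw [majority, PMF.expect_bind _ _ fun T => hF _]
  congr 1
  ext T
  rw [PMF.expect_bind _ _ fun T => hF _]
  simp only [PMF.expect_bind _ _ fun T : DecisionTree ι => hF (T.eval x), PMF.expect_pure,
    DecisionTree.eval_graft]
  rcases Int.units_eq_one_or (T.eval x) with h | h
  · simp [h, PMF.expect_const]
  · have h1 : (-1 : ℤˣ) ≠ 1 := by decide
    simp [h, h1, PMF.expect_const, sub_eq_add_neg]

/-- Both continuations are sampled in advance, but a fixed input follows only one of them, so each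
round costs one run of `R`. -/
lemma queriesAt_majority (R : RandomizedDecisionTree ι) (t : ℕ) (s : ℤ) (x : ι → ℤˣ) :
    (majority R t s).queriesAt x = t * R.queriesAt x := by
  induction t generalizing s with
  | zero => simp [majority, queriesAt, DecisionTree.numQueries]
  | succ t ih =>
    have hconst : ∀ (p : PMF (DecisionTree ι)) (c : ℝ≥0∞), ∑' T, p T * c = c := fun p c => by
      rw [ENNReal.tsum_mul_right, p.tsum_coe, one_mul]
    have hadd : ∀ (p : PMF (DecisionTree ι)) (c : ℝ≥0∞) (F : DecisionTree ι → ℝ≥0∞),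
        ∑' T, p T * (c + F T) = c + ∑' T, p T * F T := fun p c F => by
      simp only [mul_add]
      rw [ENNReal.tsum_add, hconst]
    have hT : ∀ T : DecisionTree ι, ∑' A, majority R t (s + 1) A * ∑' B, majority R t (s - 1) B *
        ((T.graft fun b => if b = 1 then A else B).numQueries x : ℝ≥0∞) =
        (T.numQueries x : ℝ≥0∞) + t * R.queriesAt x := by
      intro T
      simp only [DecisionTree.numQueries_graft, Nat.cast_add]
      rcases Int.units_eq_one_or (T.eval x) with h | h
      · simp only [h, if_true, hconst]
        rw [hadd, ← ih (s + 1), queriesAt]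
      · have h1 : (-1 : ℤˣ) ≠ 1 := by decide
        simp only [h, h1, if_false, hconst]
        rw [hadd, ← ih (s - 1), queriesAt]
    rw [queriesAt, majority, PMF.tsum_bind_mul]
    simp only [PMF.tsum_bind_mul, PMF.tsum_pure_mul, hT]
    simp only [mul_add]
    rw [ENNReal.tsum_add, hconst, queriesAt]
    push_cast
    ring

lemma exp_neg_mul_unit (η : ℝ) (u : ℤˣ) :
    Real.exp (-(η * ((u : ℤ) : ℝ))) = Real.cosh η + -Real.sinh η * ((u : ℤ) : ℝ) := by
  rcases Int.units_eq_one_or u with rfl | rfl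
  · simp [← Real.cosh_sub_sinh, sub_eq_add_neg]
  · simp [← Real.cosh_add_sinh]

/-- Chernoff bound for the majority vote. -/
lemma expect_error_majority_le (R : RandomizedDecisionTree ι) (x : ι → ℤˣ) (b : ℤˣ) (η : ℝ)
    (hη : 0 ≤ η) (t : ℕ) (s : ℤ) :
    ((majority R t s).expect fun T => if T.eval x ≠ b then 1 else 0) ≤
      Real.exp (-(η * (s * ((b : ℤ) : ℝ)))) *
        (Real.cosh η - Real.sinh η * (((b : ℤ) : ℝ) * R.mean x)) ^ t := by
  induction t generalizing s with
  | zero =>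
    rw [majority, PMF.expect_pure, pow_zero, mul_one]
    -- An error forces `s * b ≤ 0`, so the exponential is at least `1`. A tie gives exactly `1`,
    -- hence the tie-breaking rule is immaterial.
    simp only [DecisionTree.eval]
    split_ifs with h1 h2
    · apply Real.one_le_exp
      have : b = -1 := by
        rcases Int.units_eq_one_or b with rfl | rfl
        · exact absurd rfl h2
        · rfl
      subst this
      have : (0 : ℝ) ≤ s := by exact_mod_cast h1
      simpa using mul_nonneg hη this
    · positivity
    · rename_i h2
      apply Real.one_le_exp
      have : b = 1 := by
        rcases Int.units_eq_one_or b with rfl | rfl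
        · rfl
        · exact absurd rfl h2
      subst this
      have : (s : ℝ) ≤ 0 := by exact_mod_cast (not_le.1 h1).le
      simpa using mul_nonpos_of_nonneg_of_nonpos hη this
    · positivity
  | succ t ih =>
    set ρ := Real.cosh η - Real.sinh η * (((b : ℤ) : ℝ) * R.mean x) with hρ
    -- `ρ` is the exponential moment of one vote, by which each round multiplies the bound.
    have hρe : ρ = R.expect fun T => Real.exp (-(η * (((T.eval x * b : ℤˣ) : ℤ) : ℝ))) := by
      simp only [exp_neg_mul_unit]
      rw [PMF.expect_add (F := fun _ => Real.cosh η)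
        (G := fun T : DecisionTree ι => -Real.sinh η * (((T.eval x * b : ℤˣ) : ℤ) : ℝ))
        (B := |Real.cosh η|) (C := |Real.sinh η|), PMF.expect_const,
        PMF.expect_mul_left, hρ, mean, ← PMF.expect_mul_left]
      · push_cast
        simp only [mul_comm, neg_mul, sub_eq_add_neg]
      · exact fun _ => le_rfl
      · intro T
        rw [abs_mul, Int.units_abs_cast, mul_one, abs_neg]
    have hB : ∀ T : DecisionTree ι,
        |Real.exp (-(η * (((T.eval x * b : ℤˣ) : ℤ) : ℝ)))| ≤ Real.exp η := fun T => by
      rw [Real.abs_exp, Real.exp_le_exp]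
      have := abs_le.1 (Int.units_abs_cast (T.eval x * b)).le
      nlinarith
    rw [expect_majority_succ R t s x (F := fun u => if u ≠ b then 1 else 0)
      fun u => abs_indicator_le _]
    calc (R.expect fun T => (majority R t (s + (T.eval x : ℤ))).expect
            fun A => if A.eval x ≠ b then 1 else 0)
        ≤ R.expect fun T => (Real.exp (-(η * (s * ((b : ℤ) : ℝ)))) * ρ ^ t) *
            Real.exp (-(η * (((T.eval x * b : ℤˣ) : ℤ) : ℝ))) := by
          refine R.expect_mono (B := 1)
            (C := |Real.exp (-(η * (s * ((b : ℤ) : ℝ)))) * ρ ^ t| * Real.exp η)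
            (fun T => PMF.abs_expect_le _ fun A => abs_indicator_le _) (fun T => ?_) fun T => ?_
          · rw [abs_mul]
            exact mul_le_mul_of_nonneg_left (hB T) (abs_nonneg _)
          · refine (ih _).trans_eq ?_
            rw [mul_right_comm, ← Real.exp_add]
            push_cast
            ring_nf
      _ = _ := by
          rw [PMF.expect_mul_left, ← hρe]
          ring

/-- The Chernoff parameter is taken equal to the advantage `a`: the gain `a * sinh a ≥ a²` beats the
second-order cost `a² / 2` of `cosh a`. -/
lemma cosh_sub_mul_sinh_le {a m : ℝ} (ha : 0 ≤ a) (ha1 : a ≤ 1) (hm : a ≤ m) :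
    Real.cosh a - Real.sinh a * m ≤ Real.exp (-(a ^ 2 / 4)) := by
  have h1 := Real.cosh_le_exp_half_sq a
  have h2 := Real.self_le_sinh_iff.2 ha
  have ha2 : a ^ 2 ≤ 1 := by nlinarith
  have h3 : Real.exp (a ^ 2 / 2) ≤ 1 + a ^ 2 / 2 + (a ^ 2 / 2) ^ 2 := by
    have := (abs_le.1 (Real.abs_exp_sub_one_sub_id_le (x := a ^ 2 / 2)
      (by rw [abs_of_nonneg (by positivity)]; linarith))).2
    linarith
  have h4 := Real.add_one_le_exp (-(a ^ 2 / 4))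
  have h5 : a * a ≤ Real.sinh a * m := mul_le_mul h2 hm ha (ha.trans h2)
  nlinarith [sq_nonneg a]

variable [Fintype ι] [DecidableEq ι]

lemma expectedDepth_majority (μ : PMF (ι → ℤˣ)) (R : RandomizedDecisionTree ι) (t : ℕ) (s : ℤ) :
    (majority R t s).expectedDepth μ = t * R.expectedDepth μ := by
  simp only [expectedDepth_eq_sum_queriesAt, queriesAt_majority, Finset.mul_sum]
  exact Finset.sum_congr rfl fun x _ => by ring

/-- Inputs with advantage below `a` are charged error `1`; the Chernoff bound handles the others. -/
lemma toReal_error_majority_le (μ : PMF (ι → ℤˣ)) (f : (ι → ℤˣ) → ℤˣ)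
    (R : RandomizedDecisionTree ι) (t : ℕ) {a : ℝ} (ha : 0 ≤ a) (ha1 : a ≤ 1) :
    ((majority R t 0).error μ f).toReal ≤
      (∑ x, (μ x).toReal * if ((f x : ℤ) : ℝ) * R.mean x < a then 1 else 0) +
        Real.exp (-(t * (a ^ 2 / 4))) := by
  have h : Real.exp (-(t * (a ^ 2 / 4))) =
      ∑ x, (μ x).toReal * Real.exp (-(t * (a ^ 2 / 4))) := by
    rw [← Finset.sum_mul, PMF.sum_toReal, one_mul]
  rw [toReal_error, h, ← Finset.sum_add_distrib]
  refine Finset.sum_le_sum fun x _ => ?_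
  rw [← mul_add]
  refine mul_le_mul_of_nonneg_left ?_ ENNReal.toReal_nonneg
  split_ifs with hx
  · refine le_add_of_le_of_nonneg ?_ (Real.exp_nonneg _)
    exact (abs_le.1 (PMF.abs_expect_le _ fun T => abs_indicator_le _)).2
  · rw [zero_add]
    refine (expect_error_majority_le R x (f x) a ha t 0).trans ?_
    have hc := cosh_sub_mul_sinh_le ha ha1 (not_lt.1 hx)
    have h0 : 0 ≤ Real.cosh a - Real.sinh a * (((f x : ℤ) : ℝ) * R.mean x) := by
      have h1 : ((f x : ℤ) : ℝ) * R.mean x ≤ 1 := by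
        refine (le_abs_self _).trans ?_
        rw [abs_mul, Int.units_abs_cast, one_mul]
        exact R.abs_mean_le x
      have h2 := Real.cosh_sub_sinh a
      have h3 := Real.exp_pos (-a)
      have h4 := Real.sinh_nonneg_iff.2 ha
      nlinarith
    have := pow_le_pow_left₀ h0 hc t
    rw [← Real.exp_nat_mul] at this
    simpa using this

end RandomizedDecisionTree

open RandomizedDecisionTree in
/-- A tree of small depth has no advantage on a noticeable set of inputs. -/
lemma depthComplexity_le_of_amplify {ι : Type} [Fintype ι] [DecidableEq ι] (μ : PMF (ι → ℤˣ))
    (f : (ι → ℤˣ) → ℤˣ) {δ a : ℝ} {t : ℕ} (ha : 0 ≤ a) (ha1 : a ≤ 1)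
    (ht : Real.exp (-(t * (a ^ 2 / 4))) ≤ δ / 2) (R : RandomizedDecisionTree ι)
    (hR : (∑ x, (μ x).toReal * if ((f x : ℤ) : ℝ) * R.mean x < a then 1 else 0) ≤ δ / 2) :
    depthComplexity μ f δ ≤ t * R.expectedDepth μ := by
  rw [← expectedDepth_majority μ R t 0]
  refine iInf₂_le (majority R t 0) ?_
  have := toReal_error_majority_le μ f R t ha ha1
  linarith

/-! ### A smooth convex potential. -/

/-- The slope of the Huber-type potential: `1` below `a`, `0` above `2a`, linear in between. -/
noncomputable def huberSlope (a y : ℝ) : ℝ := max 0 (min 1 ((2 * a - y) / a))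

/-- The Huber-type potential, the maximum over `h ∈ [0, 1]` of `h (2a - y) - (a / 2) h²`. -/
noncomputable def huber (a y : ℝ) : ℝ :=
  huberSlope a y * (2 * a - y) - a / 2 * huberSlope a y ^ 2

lemma huberSlope_nonneg (a y : ℝ) : 0 ≤ huberSlope a y := le_max_left _ _

lemma huberSlope_le_one (a y : ℝ) : huberSlope a y ≤ 1 :=
  max_le zero_le_one (min_le_left _ _)

lemma huberSlope_eq_one {a y : ℝ} (ha : 0 < a) (hy : y ≤ a) : huberSlope a y = 1 := by
  have : 1 ≤ (2 * a - y) / a := by rw [le_div_iff₀ ha]; linarith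
  rw [huberSlope, min_eq_left this, max_eq_right zero_le_one]

lemma huberSlope_mul_le {a : ℝ} (ha : 0 < a) (y : ℝ) :
    huberSlope a y * y ≤ 2 * a * huberSlope a y := by
  rcases le_total y (2 * a) with h | h
  · nlinarith [huberSlope_nonneg a y]
  · have h1 : (2 * a - y) / a ≤ 0 := div_nonpos_of_nonpos_of_nonneg (by linarith) ha.le
    have : huberSlope a y = 0 := max_eq_left ((min_le_right _ _).trans h1)
    simp [this]

lemma abs_huberSlope_sub_le {a : ℝ} (ha : 0 < a) (y z : ℝ) :
    |huberSlope a y - huberSlope a z| ≤ |y - z| / a := by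
  have h1 := abs_max_sub_max_le_abs (min 1 ((2 * a - y) / a)) (min 1 ((2 * a - z) / a)) 0
  have h2 := abs_min_sub_min_le_max 1 ((2 * a - y) / a) 1 ((2 * a - z) / a)
  have h3 : |(2 * a - y) / a - (2 * a - z) / a| = |y - z| / a := by
    rw [← sub_div, abs_div, abs_of_pos ha, abs_sub_comm y z]
    congr 2
    ring
  rw [sub_self, abs_zero, h3, max_eq_right (by positivity)] at h2
  rw [huberSlope, huberSlope, max_comm 0, max_comm 0]
  exact h1.trans h2

lemma le_huber {a : ℝ} (ha : 0 < a) (y : ℝ) {h : ℝ} (h0 : 0 ≤ h) (h1 : h ≤ 1) :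
    h * (2 * a - y) - a / 2 * h ^ 2 ≤ huber a y := by
  unfold huber huberSlope
  set q := (2 * a - y) / a with hq
  have hy : 2 * a - y = a * q := by rw [hq]; field_simp
  rw [hy]
  rcases le_total q 0 with h2 | h2
  · have : max 0 (min 1 q) = 0 := max_eq_left ((min_le_right _ _).trans h2)
    rw [this]
    have : h * (a * q) ≤ 0 :=
      mul_nonpos_of_nonneg_of_nonpos h0 (mul_nonpos_of_nonneg_of_nonpos ha.le h2)
    have : 0 ≤ a / 2 * h ^ 2 := by positivity
    linarith
  · rcases le_total q 1 with h3 | h3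
    · rw [min_eq_right h3, max_eq_right h2]
      have : 0 ≤ a * (q - h) ^ 2 := by positivity
      linarith
    · rw [min_eq_left h3, max_eq_right zero_le_one]
      have : 0 ≤ a * ((1 - h) * (2 * q - 1 - h)) :=
        mul_nonneg ha.le (mul_nonneg (by linarith) (by linarith))
      linarith

lemma huber_nonneg {a : ℝ} (ha : 0 < a) (y : ℝ) : 0 ≤ huber a y := by
  simpa using le_huber ha y le_rfl zero_le_one

/-- Smoothness of the potential, whose derivative is `-huberSlope`. Testing the maximum at `y` with
the slope of `y + u` leaves the difference of slopes times `u`, and the slope is `1 / a`-Lipschitz.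
-/
lemma huber_add_le {a : ℝ} (ha : 0 < a) (y u : ℝ) :
    huber a (y + u) ≤ huber a y - huberSlope a y * u + u ^ 2 / a := by
  have h1 := le_huber ha y (huberSlope_nonneg a (y + u)) (huberSlope_le_one a (y + u))
  have h2 := abs_huberSlope_sub_le ha y (y + u)
  have h3 : (huberSlope a y - huberSlope a (y + u)) * u ≤ u ^ 2 / a := by
    refine (le_abs_self _).trans ?_
    rw [abs_mul]
    refine (mul_le_mul_of_nonneg_right h2 (abs_nonneg u)).trans_eq ?_
    rw [sub_add_cancel_left, abs_neg, div_mul_eq_mul_div, ← sq, sq_abs]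
  rw [huber]
  linarith

/-! ### The hardcore measure. -/

namespace RandomizedDecisionTree

variable {ι : Type}

/-- The outcome of a coin that shows `true` with probability `t`. -/
noncomputable def coin (t : NNReal) (ht : t ≤ 1) : PMF Bool :=
  PMF.ofFintype (fun b => ((cond b t (1 - t) : NNReal) : ℝ≥0∞)) (by
    rw [← ENNReal.ofNNReal_finsetSum]
    simp [add_tsub_cancel_of_le ht])

/-- Run `S` with probability `t` and `R` with probability `1 - t`. -/
noncomputable def mix (t : NNReal) (ht : t ≤ 1) (R S : RandomizedDecisionTree ι) :
    RandomizedDecisionTree ι :=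
  (coin t ht).bind fun b => cond b S R

lemma mean_mix (t : NNReal) (ht : t ≤ 1) (R S : RandomizedDecisionTree ι) (x : ι → ℤˣ) :
    (mix t ht R S).mean x = R.mean x + t * (S.mean x - R.mean x) := by
  rw [mix, mean_bind, PMF.expect_fintype]
  simp [coin, PMF.ofFintype_apply, NNReal.coe_sub ht]
  ring

variable [Fintype ι] [DecidableEq ι]

lemma expectedDepth_mix_le (μ : PMF (ι → ℤˣ)) (t : NNReal) (ht : t ≤ 1)
    {R S : RandomizedDecisionTree ι} {d : ℝ≥0∞} (hR : R.expectedDepth μ ≤ d)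
    (hS : S.expectedDepth μ ≤ d) : (mix t ht R S).expectedDepth μ ≤ d := by
  rw [mix, expectedDepth_bind]
  calc ∑' b, coin t ht b * expectedDepth μ (cond b S R)
      ≤ ∑' b, coin t ht b * d :=
        ENNReal.tsum_le_tsum fun b => by cases b <;> simpa using by gcongr
    _ = d := by rw [ENNReal.tsum_mul_right, PMF.tsum_coe, one_mul]

/-- Hardcore lemma: if no tree of expected depth at most `d` has advantage `a` outside a set of
measure less than `δ`, then some measure of density at least `δ` is hard for all such trees. -/
lemma exists_hardcore (μ : PMF (ι → ℤˣ)) (f : (ι → ℤˣ) → ℤˣ) (d : ℝ≥0∞) {a δ : ℝ}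
    (ha : 0 < a) (ha1 : a ≤ 1) (hδ : 0 < δ) (hδ1 : δ ≤ 1)
    (hweak : ∀ R : RandomizedDecisionTree ι, R.expectedDepth μ ≤ d →
      δ ≤ ∑ x, (μ x).toReal * if ((f x : ℤ) : ℝ) * R.mean x < a then 1 else 0) :
    ∃ H : (ι → ℤˣ) → ℝ, (∀ x, 0 ≤ H x) ∧ (∀ x, H x ≤ 1) ∧ δ ≤ ∑ x, (μ x).toReal * H x ∧
      ∀ R : RandomizedDecisionTree ι, R.expectedDepth μ ≤ d →
        ∑ x, (μ x).toReal * (H x * (((f x : ℤ) : ℝ) * R.mean x)) ≤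
          3 * a * ∑ x, (μ x).toReal * H x := by
  set adv : RandomizedDecisionTree ι → (ι → ℤˣ) → ℝ := fun R x => ((f x : ℤ) : ℝ) * R.mean x
    with hadv
  set Φ : RandomizedDecisionTree ι → ℝ := fun R => ∑ x, (μ x).toReal * huber a (adv R x) with hΦ
  have hΦ0 : ∀ R, 0 ≤ Φ R := fun R =>
    Finset.sum_nonneg fun x _ => mul_nonneg ENNReal.toReal_nonneg (huber_nonneg ha _)
  have habs : ∀ R x, |adv R x| ≤ 1 := fun R x => by
    rw [hadv, abs_mul, Int.units_abs_cast, one_mul]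
    exact R.abs_mean_le x
  set V : Set ℝ := Φ '' {R | R.expectedDepth μ ≤ d} with hV
  have hbdd : BddBelow V := ⟨0, by rintro _ ⟨R, -, rfl⟩; exact hΦ0 R⟩
  have hne : V.Nonempty := by
    refine ⟨_, PMF.pure (.leaf 1), ?_, rfl⟩
    simp [expectedDepth_pure, DecisionTree.expectedDepth, DecisionTree.numQueries]
  -- The mixing weight makes the second-order term `4 t² / a` equal to the slack `t (a δ / 2)`
  -- allowed to a near-minimizer, so the two cost `a δ` after division by `t`.
  set t : ℝ := a ^ 2 * δ / 8 with ht
  have ht0 : 0 < t := by positivity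
  have ht1 : t ≤ 1 := by
    have : a ^ 2 * δ ≤ 1 := mul_le_one₀ (pow_le_one₀ ha.le ha1) hδ.le hδ1
    linarith
  have hε : 0 < t * (a * δ / 2) := by positivity
  obtain ⟨_, ⟨R, hR, rfl⟩, hRV⟩ := exists_lt_of_csInf_lt hne (lt_add_of_pos_right (sInf V) hε)
  set H : (ι → ℤˣ) → ℝ := fun x => huberSlope a (adv R x) with hH
  have hHδ : δ ≤ ∑ x, (μ x).toReal * H x := by
    refine (hweak R hR).trans (Finset.sum_le_sum fun x _ => ?_)
    refine mul_le_mul_of_nonneg_left ?_ ENNReal.toReal_nonneg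
    split_ifs with h
    · exact (huberSlope_eq_one ha h.le).ge
    · exact huberSlope_nonneg _ _
  refine ⟨H, fun x => huberSlope_nonneg _ _, fun x => huberSlope_le_one _ _, hHδ,
    fun S hS => ?_⟩
  have htn : t.toNNReal ≤ 1 := by rwa [Real.toNNReal_le_one]
  -- Moving from `R` slightly towards `S` stays in the class and cannot go below the infimum. Hence
  -- the first-order gain, which is the `H`-weighted advantage of `S` over `R`, is small.
  have hmix : sInf V ≤ Φ (mix t.toNNReal htn R S) :=
    csInf_le hbdd ⟨_, expectedDepth_mix_le μ _ htn hR hS, rfl⟩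
  have hstep : Φ (mix t.toNNReal htn R S) ≤
      Φ R - t * (∑ x, (μ x).toReal * (H x * (adv S x - adv R x))) + 4 * t ^ 2 / a := by
    have hc : 4 * t ^ 2 / a = ∑ x, (μ x).toReal * (4 * t ^ 2 / a) := by
      rw [← Finset.sum_mul, PMF.sum_toReal, one_mul]
    rw [hc, hΦ, Finset.mul_sum, ← Finset.sum_sub_distrib, ← Finset.sum_add_distrib]
    refine Finset.sum_le_sum fun x _ => ?_
    have h1 : adv (mix t.toNNReal htn R S) x = adv R x + t * (adv S x - adv R x) := by
      simp only [hadv, mean_mix, Real.coe_toNNReal t ht0.le]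
      ring
    have h2 := huber_add_le ha (adv R x) (t * (adv S x - adv R x))
    have h3 : (t * (adv S x - adv R x)) ^ 2 / a ≤ 4 * t ^ 2 / a := by
      gcongr
      have h4 : |adv S x - adv R x| ≤ 2 :=
        (abs_sub _ _).trans (by linarith [habs S x, habs R x])
      have h5 : (adv S x - adv R x) ^ 2 ≤ 4 := by
        rw [← sq_abs]; nlinarith [abs_nonneg (adv S x - adv R x)]
      rw [mul_pow]
      nlinarith [sq_nonneg t]
    rw [h1]
    refine (mul_le_mul_of_nonneg_left (h2.trans (add_le_add_right h3 _))
      ENNReal.toReal_nonneg).trans_eq ?_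
    simp only [hH]
    ring
  have hsplit : ∑ x, (μ x).toReal * (H x * (adv S x - adv R x)) =
      ∑ x, (μ x).toReal * (H x * adv S x) - ∑ x, (μ x).toReal * (H x * adv R x) := by
    rw [← Finset.sum_sub_distrib]
    exact Finset.sum_congr rfl fun x _ => by ring
  -- `R` itself has small advantage against `H`, since the slope vanishes where the advantage
  -- exceeds `2 a`.
  have hR2 : ∑ x, (μ x).toReal * (H x * adv R x) ≤ 2 * a * ∑ x, (μ x).toReal * H x := by
    rw [Finset.mul_sum]
    refine Finset.sum_le_sum fun x _ => ?_
    have := mul_le_mul_of_nonneg_left (huberSlope_mul_le ha (adv R x))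
      (ENNReal.toReal_nonneg (a := μ x))
    simp only [hH]
    linarith
  have hta : 4 * t ^ 2 / a = t * (a * δ / 2) := by
    rw [ht]; field_simp; ring
  have hmain : ∑ x, (μ x).toReal * (H x * (adv S x - adv R x)) ≤ a * δ := by
    have : t * (∑ x, (μ x).toReal * (H x * (adv S x - adv R x))) ≤ t * (a * δ) := by linarith
    exact le_of_mul_le_mul_left this ht0
  have : a * δ ≤ a * ∑ x, (μ x).toReal * H x := mul_le_mul_of_nonneg_left hHδ ha.le
  linarith

end RandomizedDecisionTree

/-! ### Product weights. -/

section Products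

variable {κ A : Type*} [Fintype κ] [DecidableEq κ] [Fintype A]

lemma sum_prod_mul_prod {K : Type*} [CommSemiring K] (w φ : κ → A → K) :
    ∑ Y : κ → A, (∏ i, w i (Y i)) * ∏ i, φ i (Y i) = ∏ i, ∑ x, w i x * φ i x := by
  rw [Fintype.prod_sum]
  simp only [Finset.prod_mul_distrib]

lemma sum_prod_mul_single {K : Type*} [CommSemiring K] (w : κ → A → K) (g : A → K) (i : κ) :
    ∑ Y : κ → A, (∏ j, w j (Y j)) * g (Y i) =
      (∑ x, w i x * g x) * ∏ j ∈ Finset.univ.erase i, ∑ x, w j x := by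
  have h : ∀ Y : κ → A, g (Y i) = ∏ j, (if j = i then g else fun _ => 1) (Y j) := fun Y => by
    rw [Finset.prod_eq_single i]
    · simp
    · intro j _ hj
      simp [hj]
    · simp
  simp only [h]
  rw [sum_prod_mul_prod, ← Finset.mul_prod_erase _ _ (Finset.mem_univ i)]
  congr 1
  · simp
  · refine Finset.prod_congr rfl fun j hj => ?_
    simp [Finset.ne_of_mem_erase hj]

/-- Resampling one coordinate of a product distribution. -/
lemma sum_prod_update {K : Type*} [CommSemiring K] (m : A → K) (hm : ∑ x, m x = 1)
    (F : (κ → A) → K) (i : κ) :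
    ∑ Y : κ → A, (∏ j, m (Y j)) * ∑ x, m x * F (Function.update Y i x) =
      ∑ Y : κ → A, (∏ j, m (Y j)) * F Y := by
  -- Swapping the old coordinate with the fresh one preserves the joint weight.
  have hinv : Function.Involutive
      fun q : (κ → A) × A => (Function.update q.1 i q.2, q.1 i) := fun q => by simp
  have hprod : ∀ (Y : κ → A) (x : A),
      (∏ j, m (Function.update Y i x j)) * m (Y i) = (∏ j, m (Y j)) * m x := fun Y x => by
    rw [← Finset.mul_prod_erase _ _ (Finset.mem_univ i),
      ← Finset.mul_prod_erase _ (fun j => m (Y j)) (Finset.mem_univ i), Function.update_self,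
      Finset.prod_congr rfl fun j hj => by
        rw [Function.update_of_ne (Finset.ne_of_mem_erase hj)]]
    ring
  calc ∑ Y : κ → A, (∏ j, m (Y j)) * ∑ x, m x * F (Function.update Y i x)
      = ∑ q : (κ → A) × A, (∏ j, m (q.1 j)) * m q.2 * F (Function.update q.1 i q.2) := by
        rw [Fintype.sum_prod_type]
        simp only [Finset.mul_sum, mul_assoc]
    _ = ∑ q : (κ → A) × A, (∏ j, m (q.1 j)) * m q.2 * F q.1 := by
        rw [← Equiv.sum_comp hinv.toPerm]
        refine Finset.sum_congr rfl fun q _ => ?_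
        simp [Function.Involutive.coe_toPerm, hprod]
    _ = ∑ Y : κ → A, (∏ j, m (Y j)) * F Y := by
        rw [Fintype.sum_prod_type]
        refine Finset.sum_congr rfl fun Y _ => ?_
        simp only
        rw [← Finset.sum_mul, ← Finset.mul_sum, hm, mul_one]

-- Used at a leaf, with `M i` the mass of block `i`, `h i` its `H`-mass and `α i` its correlation
-- with `f` against `H`. The two terms on the right answer to the cases `∑ α i / M i ≤ θ` and `≥ θ`.
-- Only half of `h i` is kept, so that `M i - h i / 2 ≥ M i / 2` and the additive `α i` can be
-- absorbed into the factor `1 + 2 α i / M i`.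
omit [Fintype A] in
lemma prod_le_exp_mul_prod_add {F M h α : κ → ℝ} {θ : ℝ} (hθ : 0 < θ) (hF0 : ∀ i, 0 ≤ F i)
    (hFM : ∀ i, F i ≤ M i) (h0 : ∀ i, 0 ≤ h i) (hM : ∀ i, h i ≤ M i) (hα : ∀ i, 0 ≤ α i)
    (hF : ∀ i, F i ≤ M i - h i + α i) :
    ∏ i, F i ≤ Real.exp (2 * θ) * ∏ i, (M i - h i / 2) +
      θ⁻¹ * ∑ i, α i * ∏ j ∈ Finset.univ.erase i, M j := by
  have hM0 : ∀ i, 0 ≤ M i := fun i => (h0 i).trans (hM i)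
  have hP : 0 ≤ Real.exp (2 * θ) * ∏ i, (M i - h i / 2) :=
    mul_nonneg (Real.exp_nonneg _)
      (Finset.prod_nonneg fun i _ => by linarith [h0 i, hM i, hM0 i])
  have hS : 0 ≤ θ⁻¹ * ∑ i, α i * ∏ j ∈ Finset.univ.erase i, M j :=
    mul_nonneg (inv_nonneg.2 hθ.le) (Finset.sum_nonneg fun i _ =>
      mul_nonneg (hα i) (Finset.prod_nonneg fun j _ => hM0 j))
  by_cases hz : ∃ i, M i = 0
  · obtain ⟨i, hi⟩ := hz
    rw [Finset.prod_eq_zero (Finset.mem_univ i) (le_antisymm (hi ▸ hFM i) (hF0 i))]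
    exact add_nonneg hP hS
  push Not at hz
  have hMpos : ∀ i, 0 < M i := fun i => (hM0 i).lt_of_ne' (hz i)
  have hsum : ∑ i, α i * ∏ j ∈ Finset.univ.erase i, M j = (∑ i, α i / M i) * ∏ i, M i := by
    rw [Finset.sum_mul]
    refine Finset.sum_congr rfl fun i _ => ?_
    rw [← Finset.mul_prod_erase _ M (Finset.mem_univ i), ← mul_assoc, div_mul_cancel₀ _ (hz i)]
  rcases le_total (∑ i, α i / M i) θ with hle | hle
  · refine le_add_of_le_of_nonneg ?_ hS
    calc ∏ i, F i ≤ ∏ i, Real.exp (2 * (α i / M i)) * (M i - h i / 2) := by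
          refine Finset.prod_le_prod (fun i _ => hF0 i) fun i _ => (hF i).trans ?_
          have h1 := Real.add_one_le_exp (2 * (α i / M i))
          have h2 : 0 ≤ M i - h i / 2 := by linarith [h0 i, hM i, hM0 i]
          refine le_trans ?_ (mul_le_mul_of_nonneg_right h1 h2)
          have h3 : α i / M i * M i = α i := div_mul_cancel₀ _ (hz i)
          have h4 : α i / M i * h i ≤ α i / M i * M i :=
            mul_le_mul_of_nonneg_left (hM i) (div_nonneg (hα i) (hM0 i))
          linarith [h0 i]
      _ = Real.exp (2 * ∑ i, α i / M i) * ∏ i, (M i - h i / 2) := by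
          rw [Finset.prod_mul_distrib, ← Real.exp_sum, Finset.mul_sum]
      _ ≤ _ := by
          refine mul_le_mul_of_nonneg_right (Real.exp_le_exp.2 (by linarith))
            (Finset.prod_nonneg fun i _ => by linarith [h0 i, hM i, hM0 i])
  · refine le_add_of_nonneg_of_le hP ?_
    rw [hsum, ← mul_assoc]
    refine (Finset.prod_le_prod (fun i _ => hF0 i) fun i _ => hFM i).trans ?_
    refine le_mul_of_one_le_left (Finset.prod_nonneg fun i _ => hM0 i) ?_
    rw [inv_mul_eq_div]
    exact (one_le_div hθ).2 hle

end Products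

/-! ### Decomposing a tree into single-block trees. -/

section Blocks

variable {κ ι : Type} [Fintype κ] [DecidableEq κ]

/-- Condition the weight of block `p.1` on its coordinate `p.2` being `b`. -/
def restrictWeight (w : κ → (ι → ℤˣ) → ℝ) (p : κ × ι) (b : ℤˣ) : κ → (ι → ℤˣ) → ℝ :=
  Function.update w p.1 fun x => if x p.2 = b then w p.1 x else 0

omit [Fintype κ] in
lemma restrictWeight_nonneg {w : κ → (ι → ℤˣ) → ℝ} (hw : ∀ i x, 0 ≤ w i x) (p : κ × ι)
    (b : ℤˣ) (i : κ) (x : ι → ℤˣ) : 0 ≤ restrictWeight w p b i x := by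
  by_cases h : i = p.1
  · subst h
    rw [restrictWeight, Function.update_self]
    split_ifs
    · exact hw _ _
    · exact le_rfl
  · rw [restrictWeight, Function.update_of_ne h]
    exact hw _ _

lemma prod_restrictWeight (w : κ → (ι → ℤˣ) → ℝ) (p : κ × ι) (b : ℤˣ) (Y : κ → ι → ℤˣ) :
    ∏ i, restrictWeight w p b i (Y i) = if Y p.1 p.2 = b then ∏ i, w i (Y i) else 0 := by
  split_ifs with h
  · refine Finset.prod_congr rfl fun i _ => ?_
    by_cases hi : i = p.1
    · subst hi
      rw [restrictWeight, Function.update_self, if_pos h]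
    · rw [restrictWeight, Function.update_of_ne hi]
  · refine Finset.prod_eq_zero (Finset.mem_univ p.1) ?_
    rw [restrictWeight, Function.update_self, if_neg h]

variable [Fintype ι] [DecidableEq ι]

/-- Weights are left unnormalized, so a query splits every sum additively and keeps the product
form. -/
lemma sum_restrictWeight_add (w : κ → (ι → ℤˣ) → ℝ) (p : κ × ι) (F A B : (κ → ι → ℤˣ) → ℝ)
    (hA : ∀ Y, Y p.1 p.2 = -1 → F Y = A Y) (hB : ∀ Y, Y p.1 p.2 ≠ -1 → F Y = B Y) :
    ∑ Y : κ → ι → ℤˣ, (∏ i, w i (Y i)) * F Y =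
      ∑ Y : κ → ι → ℤˣ, (∏ i, restrictWeight w p (-1) i (Y i)) * A Y +
        ∑ Y : κ → ι → ℤˣ, (∏ i, restrictWeight w p 1 i (Y i)) * B Y := by
  rw [← Finset.sum_add_distrib]
  refine Finset.sum_congr rfl fun Y _ => ?_
  rw [prod_restrictWeight, prod_restrictWeight]
  have h1 : (1 : ℤˣ) ≠ -1 := by decide
  by_cases h : Y p.1 p.2 = -1
  · rw [if_pos h, if_neg (by rw [h]; exact h1.symm), hA Y h, zero_mul, add_zero]
  · rw [if_neg h, if_pos ((Int.units_eq_one_or _).resolve_right h), hB Y h, zero_mul, zero_add]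

namespace DecisionTree

/-- The tree on block `i` obtained from `T` by fixing the other blocks to those of `Y`, and
labelling each leaf by the sign of the correlation of `g` with the weight of block `i` there. -/
noncomputable def blockTree (g : (ι → ℤˣ) → ℝ) (i : κ) :
    DecisionTree (κ × ι) → (κ → (ι → ℤˣ) → ℝ) → (κ → ι → ℤˣ) → DecisionTree ι
  | leaf _, w, _ => leaf (if 0 ≤ ∑ x, w i x * g x then 1 else -1)
  | node p l r, w, Y =>
    if p.1 = i then
      node p.2 (blockTree g i l (restrictWeight w p (-1)) Y)
        (blockTree g i r (restrictWeight w p 1) Y)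
    else if Y p.1 p.2 = -1 then blockTree g i l (restrictWeight w p (-1)) Y
    else blockTree g i r (restrictWeight w p 1) Y

variable (g : (ι → ℤˣ) → ℝ)

-- This independence from the block `Y i` allows a fresh input to be put at position `i`.
omit [Fintype κ] in
lemma blockTree_update (i : κ) (T : DecisionTree (κ × ι)) (w : κ → (ι → ℤˣ) → ℝ)
    (Y : κ → ι → ℤˣ) (x : ι → ℤˣ) :
    blockTree g i T w (Function.update Y i x) = blockTree g i T w Y := by
  induction T generalizing w with
  | leaf b => rfl
  | node p l r hl hr =>
    simp only [blockTree, hl, hr]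
    by_cases h : p.1 = i
    · simp [h]
    · simp [h]

omit [Fintype κ] in
lemma eval_blockTree_node (i : κ) (p : κ × ι) (l r : DecisionTree (κ × ι))
    (w : κ → (ι → ℤˣ) → ℝ) (Y : κ → ι → ℤˣ) :
    (blockTree g i (node p l r) w Y).eval (Y i) =
      if Y p.1 p.2 = -1 then (blockTree g i l (restrictWeight w p (-1)) Y).eval (Y i)
      else (blockTree g i r (restrictWeight w p 1) Y).eval (Y i) := by
  rw [blockTree]
  split_ifs with h1 h2 h2
  · subst h1; simp [eval, h2]
  · subst h1; simp [eval, h2]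
  · rfl
  · rfl

omit [Fintype κ] in
lemma numQueries_blockTree_node (i : κ) (p : κ × ι) (l r : DecisionTree (κ × ι))
    (w : κ → (ι → ℤˣ) → ℝ) (Y : κ → ι → ℤˣ) :
    (blockTree g i (node p l r) w Y).numQueries (Y i) = (if p.1 = i then 1 else 0) +
      if Y p.1 p.2 = -1 then (blockTree g i l (restrictWeight w p (-1)) Y).numQueries (Y i)
      else (blockTree g i r (restrictWeight w p 1) Y).numQueries (Y i) := by
  rw [blockTree]
  split_ifs with h1 h2 h2
  · subst h1; simp [numQueries, h2]
  · subst h1; simp [numQueries, h2]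
  · simp
  · simp

/-- Each query on the path of `Y` is made by exactly one block tree. This is the source of the
factor `k` in the theorem. -/
lemma sum_numQueries_blockTree (T : DecisionTree (κ × ι)) (w : κ → (ι → ℤˣ) → ℝ)
    (Y : κ → ι → ℤˣ) :
    ∑ i, (blockTree g i T w Y).numQueries (Y i) = T.numQueries (Function.uncurry Y) := by
  induction T generalizing w with
  | leaf b => simp [blockTree, numQueries]
  | node p l r hl hr =>
    simp only [numQueries_blockTree_node, Finset.sum_add_distrib, numQueries]
    congr 1
    · simp
    · by_cases h : Y p.1 p.2 = -1
      · simp [Function.uncurry, h]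
        exact hl _
      · simp [Function.uncurry, h]
        exact hr _

/-- The advantage of a tree against the product of `f` over all blocks, bounded by the density
and the advantages of the block trees against the measure `H`. -/
lemma sum_eval_mul_prod_le (f : (ι → ℤˣ) → ℤˣ) (H : (ι → ℤˣ) → ℝ) (hH0 : ∀ x, 0 ≤ H x)
    (hH1 : ∀ x, H x ≤ 1) {θ : ℝ} (hθ : 0 < θ) (T : DecisionTree (κ × ι))
    (w : κ → (ι → ℤˣ) → ℝ) (hw : ∀ i x, 0 ≤ w i x) :
    ∑ Y : κ → ι → ℤˣ, (∏ i, w i (Y i)) *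
        (((T.eval (Function.uncurry Y) : ℤ) : ℝ) * ∏ i, ((f (Y i) : ℤ) : ℝ)) ≤
      Real.exp (2 * θ) * ∑ Y : κ → ι → ℤˣ, (∏ i, w i (Y i)) * ∏ i, (1 - H (Y i) / 2) +
      θ⁻¹ * ∑ i, ∑ Y : κ → ι → ℤˣ, (∏ j, w j (Y j)) * (H (Y i) * ((f (Y i) : ℤ) : ℝ) *
        (((blockTree (fun x => H x * ((f x : ℤ) : ℝ)) i T w Y).eval (Y i) : ℤ) : ℝ)) := by
  induction T generalizing w with
  | leaf b =>
    simp only [eval, blockTree]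
    -- The weight at a leaf is a product, so the advantage factors over the blocks.
    have h1 : ∑ Y : κ → ι → ℤˣ, (∏ i, w i (Y i)) *
        (((b : ℤ) : ℝ) * ∏ i, ((f (Y i) : ℤ) : ℝ)) ≤ ∏ i, |∑ x, w i x * ((f x : ℤ) : ℝ)| := by
      simp only [mul_left_comm _ ((b : ℤ) : ℝ)]
      rw [← Finset.mul_sum, sum_prod_mul_prod w fun _ x => ((f x : ℤ) : ℝ)]
      refine (le_abs_self _).trans_eq ?_
      rw [abs_mul, Int.units_abs_cast, one_mul, Finset.abs_prod]
    -- The sign at the leaf of a block tree turns its correlation into an absolute value; the other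
    -- blocks contribute their masses.
    have h2 : ∀ i, ∑ Y : κ → ι → ℤˣ, (∏ j, w j (Y j)) * (H (Y i) * ((f (Y i) : ℤ) : ℝ) *
        (((if 0 ≤ ∑ x, w i x * (H x * ((f x : ℤ) : ℝ)) then (1 : ℤˣ) else -1 : ℤˣ) : ℤ) : ℝ)) =
        |∑ x, w i x * (H x * ((f x : ℤ) : ℝ))| *
          ∏ j ∈ Finset.univ.erase i, ∑ x, w j x := fun i => by
      simp only [← mul_assoc (∏ j, w j _)]
      rw [← Finset.sum_mul]
      simp only [mul_assoc (∏ j, w j _)]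
      rw [sum_prod_mul_single w (fun x => H x * ((f x : ℤ) : ℝ)), mul_right_comm]
      congr 1
      split_ifs with h
      · rw [abs_of_nonneg h]; simp
      · rw [abs_of_neg (not_le.1 h)]; simp
    have h3 : ∀ i, ∑ x, w i x * (1 - H x / 2) = ∑ x, w i x - (∑ x, w i x * H x) / 2 := fun i => by
      rw [Finset.sum_div, ← Finset.sum_sub_distrib]
      exact Finset.sum_congr rfl fun x _ => by ring
    refine h1.trans ?_
    rw [sum_prod_mul_prod w fun _ x => 1 - H x / 2]
    simp only [h2, h3]
    refine prod_le_exp_mul_prod_add hθ (fun i => abs_nonneg _) (fun i => ?_)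
      (fun i => Finset.sum_nonneg fun x _ => mul_nonneg (hw i x) (hH0 x))
      (fun i => Finset.sum_le_sum fun x _ => mul_le_of_le_one_right (hw i x) (hH1 x))
      (fun i => abs_nonneg _) fun i => ?_
    · refine (Finset.abs_sum_le_sum_abs _ _).trans (Finset.sum_le_sum fun x _ => ?_)
      rw [abs_mul, Int.units_abs_cast, mul_one, abs_of_nonneg (hw i x)]
    · have h4 : ∑ x, w i x * ((f x : ℤ) : ℝ) = ∑ x, w i x * (1 - H x) * ((f x : ℤ) : ℝ) +
          ∑ x, w i x * (H x * ((f x : ℤ) : ℝ)) := by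
        rw [← Finset.sum_add_distrib]
        exact Finset.sum_congr rfl fun x _ => by ring
      rw [h4]
      refine (abs_add_le _ _).trans (add_le_add_left ?_ _)
      rw [← Finset.sum_sub_distrib]
      refine (Finset.abs_sum_le_sum_abs _ _).trans (Finset.sum_le_sum fun x _ => ?_)
      rw [abs_mul, Int.units_abs_cast, mul_one,
        abs_of_nonneg (mul_nonneg (hw i x) (sub_nonneg.2 (hH1 x)))]
      exact (by ring : w i x * (1 - H x) = w i x - w i x * H x).le
  | node p l r hl hr =>
    -- All three sums are additive under the query at `p`, so the bounds for the subtrees add.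
    have hl' := hl _ (restrictWeight_nonneg hw p (-1))
    have hr' := hr _ (restrictWeight_nonneg hw p 1)
    rw [sum_restrictWeight_add w p _
      (fun Y => ((l.eval (Function.uncurry Y) : ℤ) : ℝ) * ∏ i, ((f (Y i) : ℤ) : ℝ))
      (fun Y => ((r.eval (Function.uncurry Y) : ℤ) : ℝ) * ∏ i, ((f (Y i) : ℤ) : ℝ))
      (fun Y h => by simp [eval, Function.uncurry, h])
      (fun Y h => by simp [eval, Function.uncurry, h]),
      sum_restrictWeight_add w p _ _ _ (fun _ _ => rfl) (fun _ _ => rfl)]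
    simp only [eval_blockTree_node]
    rw [Finset.sum_congr rfl fun i _ => sum_restrictWeight_add w p _
      (fun Y => H (Y i) * ((f (Y i) : ℤ) : ℝ) * (((blockTree (fun x => H x * ((f x : ℤ) : ℝ)) i l
        (restrictWeight w p (-1)) Y).eval (Y i) : ℤ) : ℝ))
      (fun Y => H (Y i) * ((f (Y i) : ℤ) : ℝ) * (((blockTree (fun x => H x * ((f x : ℤ) : ℝ)) i r
        (restrictWeight w p 1) Y).eval (Y i) : ℤ) : ℝ))
      (fun Y h => by simp only [h, if_true]) (fun Y h => by simp only [h, if_false]),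
      Finset.sum_add_distrib]
    linarith

end DecisionTree

end Blocks

/-! ### The XOR bound under the product distribution. -/

section ProductPower

variable {n k : ℕ}

lemma sum_productPower_mul (μ : PMF (Fin n → ℤˣ)) (F : (Fin k → Fin n → ℤˣ) → ℝ≥0∞) :
    ∑ Z, productPower μ k Z * F (Function.curry Z) =
      ∑ Y : Fin k → Fin n → ℤˣ, (∏ i, μ (Y i)) * F Y := by
  rw [← Equiv.sum_comp (Equiv.curry (Fin k) (Fin n) ℤˣ)]
  rfl

lemma sum_toReal_productPower_mul (μ : PMF (Fin n → ℤˣ)) (F : (Fin k → Fin n → ℤˣ) → ℝ) :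
    ∑ Z, (productPower μ k Z).toReal * F (Function.curry Z) =
      ∑ Y : Fin k → Fin n → ℤˣ, (∏ i, (μ (Y i)).toReal) * F Y := by
  rw [← Equiv.sum_comp (Equiv.curry (Fin k) (Fin n) ℤˣ)]
  refine Finset.sum_congr rfl fun Z _ => ?_
  rw [← ENNReal.toReal_prod]
  rfl

namespace RandomizedDecisionTree

open DecisionTree

/-- Embed a random input of a single block at a random position `i`, draw the other blocks from
`μ`, and simulate `T`. -/
noncomputable def sampledBlockTree [NeZero k] (μ : PMF (Fin n → ℤˣ)) (g : (Fin n → ℤˣ) → ℝ)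
    (T : DecisionTree (Fin k × Fin n)) : RandomizedDecisionTree (Fin n) :=
  (PMF.uniformOfFintype (Fin k)).bind fun i => (productPower μ k).bind fun Z =>
    PMF.pure (blockTree g i T (fun _ x => (μ x).toReal) (Function.curry Z))

lemma expectedDepth_sampledBlockTree [NeZero k] (μ : PMF (Fin n → ℤˣ)) (g : (Fin n → ℤˣ) → ℝ)
    (T : DecisionTree (Fin k × Fin n)) :
    (sampledBlockTree μ g T).expectedDepth μ =
      (k : ℝ≥0∞)⁻¹ * T.expectedDepth (productPower μ k) := by
  have hμ : ∑ x, μ x = 1 := by rw [← tsum_fintype (L := .unconditional _), μ.tsum_coe]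
  have hi : ∀ i : Fin k, ∑ Y : Fin k → Fin n → ℤˣ, (∏ j, μ (Y j)) *
      (blockTree g i T (fun _ x => (μ x).toReal) Y).expectedDepth μ =
      ∑ Y : Fin k → Fin n → ℤˣ, (∏ j, μ (Y j)) *
        ((blockTree g i T (fun _ x => (μ x).toReal) Y).numQueries (Y i) : ℝ≥0∞) := fun i => by
    rw [← sum_prod_update μ hμ (fun Y => ((blockTree g i T (fun _ x => (μ x).toReal) Y).numQueries
      (Y i) : ℝ≥0∞)) i]
    simp only [blockTree_update, Function.update_self, DecisionTree.expectedDepth]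
  rw [sampledBlockTree, expectedDepth_bind, tsum_fintype]
  simp only [expectedDepth_bind, expectedDepth_pure, PMF.uniformOfFintype_apply, tsum_fintype,
    Fintype.card_fin]
  rw [← Finset.mul_sum]
  congr 1
  rw [Finset.sum_congr rfl fun i _ => (sum_productPower_mul μ fun Y =>
    (blockTree g i T (fun _ x => (μ x).toReal) Y).expectedDepth μ).trans (hi i), Finset.sum_comm, DecisionTree.expectedDepth]
  refine Eq.trans ?_ (sum_productPower_mul μ fun Y =>
    (T.numQueries (Function.uncurry Y) : ℝ≥0∞)).symm
  refine Finset.sum_congr rfl fun Y _ => ?_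
  rw [← Finset.mul_sum, ← sum_numQueries_blockTree g T (fun _ x => (μ x).toReal) Y, Nat.cast_sum]

lemma sum_mean_sampledBlockTree [NeZero k] (μ : PMF (Fin n → ℤˣ)) (g : (Fin n → ℤˣ) → ℝ)
    (T : DecisionTree (Fin k × Fin n)) :
    ∑ x, (μ x).toReal * (g x * (sampledBlockTree μ g T).mean x) =
      (k : ℝ)⁻¹ * ∑ i : Fin k, ∑ Y : Fin k → Fin n → ℤˣ, (∏ j, (μ (Y j)).toReal) *
        (g (Y i) * (((blockTree g i T (fun _ x => (μ x).toReal) Y).eval (Y i) : ℤ) : ℝ)) := by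
  have hmean : ∀ x, (sampledBlockTree μ g T).mean x = (k : ℝ)⁻¹ * ∑ i : Fin k,
      ∑ Y : Fin k → Fin n → ℤˣ, (∏ j, (μ (Y j)).toReal) *
        (((blockTree g i T (fun _ x => (μ x).toReal) Y).eval x : ℤ) : ℝ) := fun x => by
    rw [sampledBlockTree, mean_bind, PMF.expect_fintype]
    simp only [mean_bind, PMF.expect_fintype, mean_pure, PMF.uniformOfFintype_apply,
      Fintype.card_fin, ENNReal.toReal_inv, ENNReal.toReal_natCast]
    rw [← Finset.mul_sum]
    congr 1
    exact Finset.sum_congr rfl fun i _ => sum_toReal_productPower_mul μ fun Y =>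
      (((blockTree g i T (fun _ x => (μ x).toReal) Y).eval x : ℤ) : ℝ)
  have hi : ∀ i : Fin k, ∑ Y : Fin k → Fin n → ℤˣ, (∏ j, (μ (Y j)).toReal) *
      (g (Y i) * (((blockTree g i T (fun _ x => (μ x).toReal) Y).eval (Y i) : ℤ) : ℝ)) =
      ∑ Y : Fin k → Fin n → ℤˣ, (∏ j, (μ (Y j)).toReal) * ∑ x, (μ x).toReal *
        (g x * (((blockTree g i T (fun _ x => (μ x).toReal) Y).eval x : ℤ) : ℝ)) := fun i => by
    rw [← sum_prod_update (fun x => (μ x).toReal) μ.sum_toReal (fun Y => g (Y i) *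
      (((blockTree g i T (fun _ x => (μ x).toReal) Y).eval (Y i) : ℤ) : ℝ)) i]
    simp only [blockTree_update, Function.update_self]
  simp only [hmean, hi, Finset.mul_sum]
  rw [Finset.sum_comm]
  refine Finset.sum_congr rfl fun i _ => ?_
  rw [Finset.sum_comm]
  refine Finset.sum_congr rfl fun Y _ => Finset.sum_congr rfl fun x _ => ?_
  ring

lemma sum_mean_bind {α ι : Type} [Fintype ι] [DecidableEq ι] (p : PMF α)
    (S : α → RandomizedDecisionTree ι) (G : (ι → ℤˣ) → ℝ) :
    ∑ x, G x * mean (p.bind S) x = p.expect fun a => ∑ x, G x * (S a).mean x := by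
  rw [PMF.expect_sum (F := fun x a => G x * (S a).mean x) (B := fun x => |G x|)]
  · simp only [mean_bind, PMF.expect_mul_left]
  · intro x a
    rw [abs_mul]
    exact mul_le_of_le_one_right (abs_nonneg _) (abs_mean_le _ _)

/-- Hardness of a measure against trees of depth `d` bounds the advantage against the XOR of
trees of depth `k d`. -/
lemma sum_xorPower_mul_mean_le [NeZero k] (μ : PMF (Fin n → ℤˣ)) (f : (Fin n → ℤˣ) → ℤˣ)
    (H : (Fin n → ℤˣ) → ℝ) (hH0 : ∀ x, 0 ≤ H x) (hH1 : ∀ x, H x ≤ 1) {η : ℝ}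
    (hp : 0 < ∑ x, (μ x).toReal * H x) (R : RandomizedDecisionTree (Fin k × Fin n))
    (hH : ∀ S : RandomizedDecisionTree (Fin n),
      S.expectedDepth μ ≤ (k : ℝ≥0∞)⁻¹ * R.expectedDepth (productPower μ k) →
        ∑ x, (μ x).toReal * (H x * (((f x : ℤ) : ℝ) * S.mean x)) ≤
          η * ∑ x, (μ x).toReal * H x) :
    ∑ Z, (productPower μ k Z).toReal * (((xorPower f k Z : ℤ) : ℝ) * R.mean Z) ≤
      Real.exp (-((∑ x, (μ x).toReal * H x) * k / 4)) + 8 * η := by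
  set p := ∑ x, (μ x).toReal * H x with hpdef
  have hk : (0 : ℝ) < k := Nat.cast_pos.2 (Nat.pos_of_ne_zero (NeZero.ne k))
  set g : (Fin n → ℤˣ) → ℝ := fun x => H x * ((f x : ℤ) : ℝ) with hg
  -- With this threshold `exp(2θ) (1 - p/2)^k ≤ exp(p k / 4 - p k / 2)`, and the factor `k / θ = 8 /
  -- p` cancels the density in the hardness bound `η p`.
  set θ := p * k / 8 with hθ
  have hθ0 : 0 < θ := by positivity
  set S : RandomizedDecisionTree (Fin n) := R.bind (sampledBlockTree μ g) with hS
  have hSd : S.expectedDepth μ = (k : ℝ≥0∞)⁻¹ * R.expectedDepth (productPower μ k) := by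
    rw [hS, expectedDepth_bind]
    simp only [expectedDepth_sampledBlockTree]
    rw [RandomizedDecisionTree.expectedDepth, ← ENNReal.tsum_mul_left]
    exact tsum_congr fun T => by ring
  have hSc := hH S hSd.le
  set cor : DecisionTree (Fin k × Fin n) → ℝ := fun T =>
    ∑ x, (μ x).toReal * g x * (sampledBlockTree μ g T).mean x with hcor
  have hScor : ∑ x, (μ x).toReal * (H x * (((f x : ℤ) : ℝ) * S.mean x)) = R.expect cor := by
    rw [hcor, ← sum_mean_bind R _ fun x => (μ x).toReal * g x]
    exact Finset.sum_congr rfl fun x _ => by simp only [hg, hS]; ring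
  set adv : DecisionTree (Fin k × Fin n) → ℝ := fun T =>
    ∑ Z, (productPower μ k Z).toReal * ((xorPower f k Z : ℤ) : ℝ) * ((T.eval Z : ℤ) : ℝ)
    with hadv
  have hRadv : ∑ Z, (productPower μ k Z).toReal * (((xorPower f k Z : ℤ) : ℝ) * R.mean Z) =
      R.expect adv := by
    have := sum_mean_bind R (fun T => PMF.pure T) fun Z =>
      (productPower μ k Z).toReal * ((xorPower f k Z : ℤ) : ℝ)
    rw [PMF.bind_pure] at this
    simpa only [mean_pure, mul_assoc, hadv] using this
  have hmain : ∀ T, adv T ≤ Real.exp (-(p * k / 4)) + θ⁻¹ * k * cor T := fun T => by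
    have h1 := sum_eval_mul_prod_le f H hH0 hH1 hθ0 T (fun _ x => (μ x).toReal)
      fun _ _ => ENNReal.toReal_nonneg
    have h2 : adv T = ∑ Y : Fin k → Fin n → ℤˣ, (∏ i, (μ (Y i)).toReal) *
        (((T.eval (Function.uncurry Y) : ℤ) : ℝ) * ∏ i, ((f (Y i) : ℤ) : ℝ)) := by
      rw [← sum_toReal_productPower_mul]
      refine Finset.sum_congr rfl fun Z _ => ?_
      simp only [xorPower, Units.coe_prod, Int.cast_prod, Function.uncurry_curry]
      rw [mul_assoc, mul_comm ((T.eval Z : ℤ) : ℝ)]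
      rfl
    have h3 : cor T = (k : ℝ)⁻¹ * ∑ i : Fin k, ∑ Y : Fin k → Fin n → ℤˣ,
        (∏ j, (μ (Y j)).toReal) *
        (g (Y i) * (((blockTree g i T (fun _ x => (μ x).toReal) Y).eval (Y i) : ℤ) : ℝ)) := by
      rw [← sum_mean_sampledBlockTree]
      exact Finset.sum_congr rfl fun x _ => by rw [mul_assoc]
    have h4 : Real.exp (2 * θ) * ∑ Y : Fin k → Fin n → ℤˣ,
        (∏ i, (μ (Y i)).toReal) * ∏ i, (1 - H (Y i) / 2) ≤ Real.exp (-(p * k / 4)) := by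
      rw [sum_prod_mul_prod (fun _ x => (μ x).toReal) fun _ x => 1 - H x / 2,
        Finset.prod_const, Finset.card_univ, Fintype.card_fin]
      have h5 : ∑ x, (μ x).toReal * (1 - H x / 2) = 1 - p / 2 := by
        nth_rw 2 [← μ.sum_toReal]
        rw [hpdef, Finset.sum_div, ← Finset.sum_sub_distrib]
        exact Finset.sum_congr rfl fun x _ => by ring
      have h6 : 0 ≤ 1 - p / 2 := by
        rw [← h5]
        exact Finset.sum_nonneg fun x _ =>
          mul_nonneg ENNReal.toReal_nonneg (by linarith [hH1 x])
      have h7 : (1 - p / 2) ^ k ≤ Real.exp (-(p / 2)) ^ k :=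
        pow_le_pow_left₀ h6 (by linarith [Real.add_one_le_exp (-(p / 2))]) k
      rw [h5]
      refine (mul_le_mul_of_nonneg_left h7 (Real.exp_nonneg _)).trans_eq ?_
      rw [← Real.exp_nat_mul, ← Real.exp_add]
      congr 1
      rw [hθ]; ring
    rw [h2]
    refine h1.trans (add_le_add h4 (le_of_eq ?_))
    rw [h3, mul_assoc θ⁻¹, mul_inv_cancel_left₀ hk.ne']
  have hadvB : ∀ T, |adv T| ≤ ∑ Z, |(productPower μ k Z).toReal * ((xorPower f k Z : ℤ) : ℝ)| :=
    fun T => (Finset.abs_sum_le_sum_abs _ _).trans (Finset.sum_le_sum fun Z _ => by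
      rw [abs_mul _ ((T.eval Z : ℤ) : ℝ), Int.units_abs_cast, mul_one])
  have hcorB : ∀ T, |cor T| ≤ ∑ x, |(μ x).toReal * g x| :=
    fun T => (Finset.abs_sum_le_sum_abs _ _).trans (Finset.sum_le_sum fun x _ => by
      rw [abs_mul _ (mean _ _)]
      exact mul_le_of_le_one_right (abs_nonneg _) (abs_mean_le _ _))
  have hcorB' : ∀ T, |θ⁻¹ * k * cor T| ≤ |θ⁻¹ * k| * ∑ x, |(μ x).toReal * g x| := fun T => by
    rw [abs_mul]
    exact mul_le_mul_of_nonneg_left (hcorB T) (abs_nonneg _)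
  rw [hRadv]
  calc R.expect adv ≤ R.expect fun T => Real.exp (-(p * k / 4)) + θ⁻¹ * k * cor T :=
        R.expect_mono (C := |Real.exp (-(p * k / 4))| + |θ⁻¹ * k| * ∑ x, |(μ x).toReal * g x|)
          hadvB (fun T => (abs_add_le _ _).trans (by gcongr; exact hcorB' T)) hmain
    _ = Real.exp (-(p * k / 4)) + θ⁻¹ * k * R.expect cor := by
        rw [PMF.expect_add (F := fun _ => Real.exp (-(p * k / 4)))
          (G := fun T => θ⁻¹ * k * cor T) (hF := fun _ => le_rfl) (hG := hcorB'), PMF.expect_const,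
          PMF.expect_mul_left]
    _ ≤ Real.exp (-(p * k / 4)) + θ⁻¹ * k * (η * p) := by
        rw [← hScor]
        gcongr
    _ = Real.exp (-(p * k / 4)) + 8 * η := by
        rw [hθ]
        field_simp

end RandomizedDecisionTree

end ProductPower

/-! ### Choice of parameters and conclusion. -/

-- The better constant output suffices. This disposes of `δ ≥ 1/2`, where `log (1 / δ)` is not
-- bounded away from zero.
open RandomizedDecisionTree in
lemma depthComplexity_eq_zero_of_half_le {ι : Type} [Fintype ι] [DecidableEq ι]
    (μ : PMF (ι → ℤˣ)) (f : (ι → ℤˣ) → ℤˣ) {δ : ℝ} (hδ : 1 / 2 ≤ δ) :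
    depthComplexity μ f δ = 0 := by
  obtain ⟨b, hb⟩ : ∃ b : ℤˣ,
      0 ≤ ∑ x, (μ x).toReal * (((f x : ℤ) : ℝ) * ((b : ℤ) : ℝ)) := by
    rcases le_total 0 (∑ x, (μ x).toReal * ((f x : ℤ) : ℝ)) with h | h
    · exact ⟨1, by simpa using h⟩
    · exact ⟨-1, by simpa using h⟩
  refine le_antisymm (iInf₂_le_of_le (PMF.pure (.leaf b)) ?_ ?_) (zero_le)
  · rw [toReal_error_eq_mean]
    simp only [mean_pure, DecisionTree.eval]
    linarith
  · simp [expectedDepth_pure, DecisionTree.expectedDepth, DecisionTree.numQueries]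

open RandomizedDecisionTree in
/-- The amplification parameter times the depth per block is at least the complexity of `f`. -/
lemma depthComplexity_le_of_xorPower {n k : ℕ} [NeZero k] (μ : PMF (Fin n → ℤˣ))
    (f : (Fin n → ℤˣ) → ℤˣ) {γ δ : ℝ} (hγ : 0 < γ) (hγ1 : γ < 1) (hδ : 0 < δ) (hδ1 : δ < 1)
    {t : ℕ} (ht : Real.exp (-(t * ((γ / 48) ^ 2 / 4))) ≤ δ / 2)
    (R : RandomizedDecisionTree (Fin k × Fin n))
    (hR : (R.error (productPower μ k) (xorPower f k)).toReal ≤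
      1 / 2 * (1 - Real.exp (-(1 / 8 * (δ * (k : ℝ)))) - γ)) :
    depthComplexity μ f δ ≤ t * ((k : ℝ≥0∞)⁻¹ * R.expectedDepth (productPower μ k)) := by
  set d := (k : ℝ≥0∞)⁻¹ * R.expectedDepth (productPower μ k) with hd
  by_contra hlt
  -- With `η = 3 γ / 48` the XOR bound has additive term `8 η = γ / 2 < γ`. Density at least `δ / 2`
  -- turns `exp(-p k / 4)` into `exp(-δ k / 8)`, whence the constant `1 / 8`.
  obtain ⟨H, hH0, hH1, hHδ, hH⟩ := exists_hardcore μ f d (a := γ / 48) (δ := δ / 2)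
    (by positivity) (by linarith) (by positivity) (by linarith) fun S hS => by
      by_contra hcon
      refine hlt ((depthComplexity_le_of_amplify μ f (by positivity) (by linarith) ht S
        (not_le.1 hcon).le).trans ?_)
      gcongr
  have hadv := sum_xorPower_mul_mean_le μ f H hH0 hH1 (by linarith) R hH
  have hexp : Real.exp (-((∑ x, (μ x).toReal * H x) * k / 4)) ≤
      Real.exp (-(1 / 8 * (δ * (k : ℝ)))) := by
    rw [Real.exp_le_exp]
    have := mul_le_mul_of_nonneg_right hHδ (Nat.cast_nonneg (α := ℝ) k)
    linarith
  rw [toReal_error_eq_mean] at hR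
  linarith

theorem mainTheorem2 :
    ∃ c : ℝ, 0 < c ∧ ∃ C : ℝ, 0 < C ∧
      ∀ (n k : ℕ) (f : (Fin n → ℤˣ) → ℤˣ) (μ : PMF (Fin n → ℤˣ)) (γ δ : ℝ),
        0 < γ → γ < 1 → 0 < δ → δ < 1 →
        ENNReal.ofReal (C * (γ ^ 2 * (k : ℝ) / Real.log (1 / δ))) * depthComplexity μ f δ ≤
          depthComplexity (productPower μ k) (xorPower f k)
            (1 / 2 * (1 - Real.exp (-(c * (δ * (k : ℝ)))) - γ)) := by
  -- `23040 = 10 * 48²`, from `t ≤ 10 L / a²` and `a = γ / 48`.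
  refine ⟨1 / 8, by norm_num, 1 / 23040, by norm_num, fun n k f μ γ δ hγ hγ1 hδ hδ1 => ?_⟩
  rcases le_or_gt (1 / 2) δ with hδ2 | hδ2
  · simp [depthComplexity_eq_zero_of_half_le μ f hδ2]
  rcases Nat.eq_zero_or_pos k with rfl | hk
  · simp
  have : NeZero k := ⟨hk.ne'⟩
  set L := Real.log (1 / δ) with hL
  have hlog2 := Real.log_two_gt_d9
  have hL2 : Real.log 2 ≤ L :=
    Real.log_le_log (by norm_num) (by rw [le_div_iff₀ hδ]; linarith)
  have hL0 : 0 < L := by linarith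
  set a := γ / 48 with ha
  have ha0 : 0 < a := by positivity
  -- This makes `exp(-t a² / 4) ≤ exp(-2 L) = δ²`, which is at most `δ / 2` because `δ < 1/2`.
  -- Rounding up costs at most `2 L / a²`.
  set t := ⌈8 * L / a ^ 2⌉₊ with ht
  have ht1 : 8 * L / a ^ 2 ≤ t := Nat.le_ceil _
  have ht2 : (t : ℝ) ≤ 10 * L / a ^ 2 := by
    have h1 : (t : ℝ) < 8 * L / a ^ 2 + 1 := Nat.ceil_lt_add_one (by positivity)
    have h2 : 1 ≤ 2 * L / a ^ 2 := by
      rw [le_div_iff₀ (by positivity)]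
      have : a ^ 2 ≤ 1 := pow_le_one₀ ha0.le (by linarith)
      linarith
    have h3 : 10 * L / a ^ 2 = 8 * L / a ^ 2 + 2 * L / a ^ 2 := by ring
    linarith
  have hexp : Real.exp (-(t * (a ^ 2 / 4))) ≤ δ / 2 := by
    rw [← Real.le_log_iff_exp_le (by positivity), Real.log_div hδ.ne' (by norm_num)]
    have h1 : L = -Real.log δ := by rw [hL, one_div, Real.log_inv]
    have h2 : 8 * L ≤ t * a ^ 2 := by rwa [div_le_iff₀ (by positivity)] at ht1
    linarith
  have hscal : ENNReal.ofReal (1 / 23040 * (γ ^ 2 * (k : ℝ) / L)) * (t * (k : ℝ≥0∞)⁻¹) ≤ 1 := by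
    have hkr : (0 : ℝ) < k := Nat.cast_pos.2 hk
    rw [← ENNReal.ofReal_natCast t, ← ENNReal.ofReal_natCast k, ← ENNReal.ofReal_inv_of_pos hkr,
      ← ENNReal.ofReal_mul (by positivity), ← ENNReal.ofReal_mul (by positivity),
      ENNReal.ofReal_le_one]
    calc 1 / 23040 * (γ ^ 2 * (k : ℝ) / L) * (t * (k : ℝ)⁻¹)
        ≤ 1 / 23040 * (γ ^ 2 * (k : ℝ) / L) * (10 * L / a ^ 2 * (k : ℝ)⁻¹) := by gcongr
      _ = 1 := by rw [ha]; field_simp; norm_num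
  refine le_iInf₂ fun R hR => ?_
  calc ENNReal.ofReal (1 / 23040 * (γ ^ 2 * (k : ℝ) / L)) * depthComplexity μ f δ
      ≤ ENNReal.ofReal (1 / 23040 * (γ ^ 2 * (k : ℝ) / L)) *
          (t * ((k : ℝ≥0∞)⁻¹ * R.expectedDepth (productPower μ k))) := by
        gcongr
        exact depthComplexity_le_of_xorPower μ f hγ hγ1 hδ hδ1 hexp R hR
    _ = ENNReal.ofReal (1 / 23040 * (γ ^ 2 * (k : ℝ) / L)) * (t * (k : ℝ≥0∞)⁻¹) *
          R.expectedDepth (productPower μ k) := by ring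
    _ ≤ R.expectedDepth (productPower μ k) := mul_le_of_le_one_left (zero_le) hscal
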